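/- Let $\mathfrak C=\{0,1\}^n$ be the $n$-cube. An outmap is an arbitrary function $s\colon\mathfrak C\to\{0,1\}^n$. A vertex $u$ is a sink of $s$ if $s(u)=0^n$, and distinct vertices $u,v$ clash if $(s(u)\oplus s(v))\wedge(u\oplus v)=0^n$ (bitwise operations). In the problem Sink-or-Clash an algorithm queries an oracle for an unknown outmap $s$ and must query a sink of $s$ or both vertices of a clash. In the promise problem Sink-USO, $s$ is promised to be the outmap of a unique sink orientation (an orientation of the cube's edges in which every face has exactly one sink; $s(u)_i=1$ iff the edge $\{u,u\oplus e_i\}$ is directed away from $u$), and the algorithm must query the sink. A randomized algorithm is a probability distribution over deterministic adaptive query algorithms each of which always solves the problem. Let $\tilde t(n)$ (respectively $\tilde q(n)$) be the minimum, over randomized algorithms $\mathcal A$ for Sink-or-Clash (respectively Sink-USO) on the $n$-cube, of the maximum, over all outmaps $s$ (respectively all outmaps $s$ of unique sink orientations), of the expected number of queries that $\mathcal A$ makes on $s$. A history $H$ is a finite list of pairs (vertex, outmap value) with pairwise distinct vertices, containing no sink and no clash. A sequence $(H,P)$ is a history $H$ together with a vertex $P$ not queried in $H$. For a nonempty history $H$,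 $\sigma(H)$ is the sequence consisting of $H$ without its last entry, and the vertex of that last entry. For an outmap $s$ and a sequence $S=(H,P)$, let $M_{S,s}=|H|+1$ if $s$ agrees with $H$ and $P$ is a sink of $s$ or clashes under $s$ with a vertex of $H$, and $M_{S,s}=0$ otherwise. Consider, for $n=2$, the linear program in the variables $v$ and $(x_S)_S$: \begin{align*} \text{minimize } & v\\ \text{subject to } & \textstyle\sum_S M_{S,s}\,x_S\le v \quad\text{for all outmaps } s,\\ & \textstyle\sum_{P} x_{(\emptyset,P)}=1,\\ & \textstyle\sum_{P\text{ not queried in }H} x_{(H,P)}=x_{\sigma(H)}\quad\text{for all histories } H\ne\emptyset,\\ & x_S\ge 0\quad\text{for all sequences } S. \end{align*} Then $\tilde t(2)=\frac{46}{17}$ and $\tilde q(2)=\frac{43}{20}$, both minima being attained; in particular $\tilde q(2)<\tilde t(2)$. Moreover, the optimal value of the linear program above is attained and equals $\frac{46}{17}=\tilde t(2)$. -/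

import Mathlib

open scoped ENNReal

namespace SinkOrClash

/-- Bitstrings of length `n`: the vertices of the `n`-cube, and also the values of outmaps. -/
abbrev Bits (n : ℕ) : Type := Fin n → Bool

/-- An (arbitrary) outmap on the `n`-cube; `s u i = true` means that the edge at `u` in direction
`i` is outgoing at `u`. -/
abbrev Outmap (n : ℕ) : Type := Bits n → Bits n

/-- The all-zero bitstring. -/
def zeroBits (n : ℕ) : Bits n := fun _ => false

/-- Distinct vertices `u`, `v` with outmap values `a`, `b` clash:
`(a ⊕ b) ∧ (u ⊕ v) = 0`, where all operations are bitwise. -/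
def Clash {n : ℕ} (u a v b : Bits n) : Prop :=
  u ≠ v ∧ (fun i => (xor (a i) (b i) && xor (u i) (v i))) = zeroBits n

/-! ### Unique sink orientations -/

/-- The neighbour `u ⊕ e_i` of `u`. -/
def flipBit {n : ℕ} (u : Bits n) (i : Fin n) : Bits n := Function.update u i (!(u i))

/-- The outmap comes from an orientation of the edges of the cube: the two endpoints of every
edge agree on its direction. -/
def IsOrientation {n : ℕ} (s : Outmap n) : Prop :=
  ∀ u i, s (flipBit u i) i = !(s u i)

/-- The vertices of the face containing `u` and spanned by the set of directions `I`. -/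
def face {n : ℕ} (u : Bits n) (I : Finset (Fin n)) : Set (Bits n) :=
  {v | ∀ i, i ∉ I → v i = u i}

/-- The outmap is that of a unique sink orientation: every face has exactly one sink. -/
def IsUSO {n : ℕ} (s : Outmap n) : Prop :=
  IsOrientation s ∧
    ∀ (u : Bits n) (I : Finset (Fin n)), ∃! v, v ∈ face u I ∧ ∀ i ∈ I, s v i = false

/-! ### Query algorithms -/

/-- Deterministic query algorithms as decision trees: an algorithm either halts, or queries a
vertex `v` and continues according to the oracle's answer `s v`. -/
inductive DetAlg (n : ℕ) : Type
  | halt : DetAlg n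
  | query (v : Bits n) (next : Bits n → DetAlg n) : DetAlg n

/-- The vertices queried by the algorithm on the oracle `s`, in order. -/
def DetAlg.run {n : ℕ} (s : Outmap n) : DetAlg n → List (Bits n)
  | .halt => []
  | .query v next => v :: (next (s v)).run s

/-- The number of queries of the algorithm on the oracle `s` (repeated queries are counted). -/
def DetAlg.numQueries {n : ℕ} (A : DetAlg n) (s : Outmap n) : ℕ := (A.run s).length

/-- On oracle `s` the algorithm queries the (global) sink. -/
def DetAlg.FindsSink {n : ℕ} (A : DetAlg n) (s : Outmap n) : Prop :=
  ∃ u ∈ A.run s, s u = zeroBits n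

/-- On oracle `s` the algorithm queries both vertices of some clash. -/
def DetAlg.FindsClash {n : ℕ} (A : DetAlg n) (s : Outmap n) : Prop :=
  ∃ u ∈ A.run s, ∃ v ∈ A.run s, Clash u (s u) v (s v)

/-- A randomized algorithm is a probability distribution over deterministic ones. (There are only
countably many decision trees, so every distribution over them is a `PMF`.) -/
abbrev RandAlg (n : ℕ) : Type := PMF (DetAlg n)

/-- The randomized algorithm solves Sink-or-Clash: on every outmap whatsoever, it always queries
a sink or both vertices of a clash. -/
def RandAlg.SolvesSinkOrClash {n : ℕ} (μ : RandAlg n) : Prop :=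
  ∀ A ∈ μ.support, ∀ s : Outmap n, A.FindsSink s ∨ A.FindsClash s

/-- The randomized algorithm solves the promise problem Sink-USO: on the outmap of every unique
sink orientation, it always queries the sink. -/
def RandAlg.SolvesSinkUSO {n : ℕ} (μ : RandAlg n) : Prop :=
  ∀ A ∈ μ.support, ∀ s : Outmap n, IsUSO s → A.FindsSink s

/-- The expected number of queries on the oracle `s`. -/
noncomputable def RandAlg.expectedQueries {n : ℕ} (μ : RandAlg n) (s : Outmap n) : ℝ≥0∞ :=
  ∑' A : DetAlg n, μ A * (A.numQueries s : ℝ≥0∞)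

/-- The worst-case expected numbers of queries, over all outmaps, of the randomized algorithms
that solve Sink-or-Clash on the `n`-cube. -/
def sinkOrClashCosts (n : ℕ) : Set ℝ≥0∞ :=
  {c | ∃ μ : RandAlg n, RandAlg.SolvesSinkOrClash μ ∧
    c = ⨆ s : Outmap n, RandAlg.expectedQueries μ s}

/-- The worst-case expected numbers of queries, over all unique sink orientations, of the
randomized algorithms that solve Sink-USO on the `n`-cube. -/
def sinkUSOCosts (n : ℕ) : Set ℝ≥0∞ :=
  {c | ∃ μ : RandAlg n, RandAlg.SolvesSinkUSO μ ∧
    c = ⨆ s : {s : Outmap n // IsUSO s}, RandAlg.expectedQueries μ s.1}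

/-- The optimal expected number of queries for Sink-or-Clash on the `n`-cube. -/
noncomputable def tTilde (n : ℕ) : ℝ≥0∞ := sInf (sinkOrClashCosts n)

/-- The optimal expected number of queries for Sink-USO on the `n`-cube. -/
noncomputable def qTilde (n : ℕ) : ℝ≥0∞ := sInf (sinkUSOCosts n)

/-! ### The linear program -/

/-- A list of (vertex, outmap value) pairs is a history if its vertices are pairwise distinct, none
of them is a sink and no two of them clash. The most recent query is the head of the list. -/
def IsHistory {n : ℕ} (H : List (Bits n × Bits n)) : Prop :=
  (∀ p ∈ H, p.2 ≠ zeroBits n) ∧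
    H.Pairwise fun p q => p.1 ≠ q.1 ∧ ¬ Clash p.1 p.2 q.1 q.2

/-- Histories. -/
abbrev History (n : ℕ) : Type := {H : List (Bits n × Bits n) // IsHistory H}

/-- The empty history. -/
def History.empty (n : ℕ) : History n := ⟨[], by simp [IsHistory]⟩

/-- The vertex has not been queried in the history. -/
def Unqueried {n : ℕ} (H : List (Bits n × Bits n)) (P : Bits n) : Prop := ∀ p ∈ H, p.1 ≠ P

/-- Sequences: a history together with a vertex that has not been queried in it. -/
abbrev Sequence (n : ℕ) : Type := Σ H : History n, {P : Bits n // Unqueried H.1 P}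

theorem IsHistory.tail {n : ℕ} {p : Bits n × Bits n} {H : List (Bits n × Bits n)}
    (h : IsHistory (p :: H)) : IsHistory H :=
  ⟨fun q hq => h.1 q (List.mem_cons_of_mem _ hq), (List.pairwise_cons.1 h.2).2⟩

theorem IsHistory.unqueried {n : ℕ} {p : Bits n × Bits n} {H : List (Bits n × Bits n)}
    (h : IsHistory (p :: H)) : Unqueried H p.1 :=
  fun q hq => (((List.pairwise_cons.1 h.2).1 q hq).1).symm

/-- The sequence `σ(p :: H)` that leads to the nonempty history `p :: H`: the history `H`
together with the vertex of `p`. -/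
def leadingSequence {n : ℕ} (p : Bits n × Bits n) (H : List (Bits n × Bits n))
    (h : IsHistory (p :: H)) : Sequence n :=
  ⟨⟨H, h.tail⟩, ⟨p.1, h.unqueried⟩⟩

instance (n : ℕ) : Finite (History n) := by
  let f : History n → {l : List (Bits n × Bits n) // l.Nodup} :=
    fun H => ⟨H.1, H.2.2.imp (fun h e => h.1 (congrArg Prod.fst e))⟩
  exact Finite.of_injective f (fun a b h => Subtype.ext (congrArg (fun l => l.1) h))

noncomputable instance (n : ℕ) : Fintype (Sequence n) := Fintype.ofFinite _

noncomputable instance (n : ℕ) (H : List (Bits n × Bits n)) :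
    Fintype {P : Bits n // Unqueried H P} := Fintype.ofFinite _

open Classical in
/-- The payoff `M_{S,s}` of the sequence `S = (H, P)` against the outmap `s`: the number of
vertices queried in `S` if `s` is consistent with `H` and querying `P` reveals a sink or a clash
with a vertex of `H`; otherwise `0`. -/
noncomputable def payoff {n : ℕ} (S : Sequence n) (s : Outmap n) : ℝ :=
  if (∀ p ∈ S.1.1, s p.1 = p.2) ∧
      (s S.2.1 = zeroBits n ∨ ∃ p ∈ S.1.1, Clash p.1 p.2 S.2.1 (s S.2.1))
  then (S.1.1.length : ℝ) + 1 else 0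

/-- The constraints of the linear program for Sink-or-Clash in the variables `x` (indexed by the
sequences) and `v`; the objective is to minimize `v`. -/
structure LPFeasible (n : ℕ) (x : Sequence n → ℝ) (v : ℝ) : Prop where
  payoff_le : ∀ s : Outmap n, ∑ S : Sequence n, payoff S s * x S ≤ v
  sum_empty : ∑ P : {P : Bits n // Unqueried (History.empty n).1 P}, x ⟨History.empty n, P⟩ = 1
  sum_cons : ∀ (p : Bits n × Bits n) (H : List (Bits n × Bits n)) (h : IsHistory (p :: H)),
    ∑ P : {P : Bits n // Unqueried (p :: H) P}, x ⟨⟨p :: H, h⟩, P⟩ = x (leadingSequence p H h)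
  nonneg : ∀ S, 0 ≤ x S

end SinkOrClash

namespace SinkOrClash

/-! Each optimum is squeezed between an explicit strategy and a weighted family of hard outmaps.

The lower bounds are Yao's principle. If weights of total `W` are put on finitely many outmaps and
every correct deterministic algorithm makes at least `V` weighted queries, then every correct
randomized algorithm has worst-case cost at least `V / W` (`lowerVal_le_of_expectedQueries_le`). The
bound `V` is a game-tree recursion (`lowerVal_le`), evaluated by the kernel: `92 / 34 = 46 / 17` for
`hardOutmaps` and `43 / 20` for `hardUSOs`.

For the upper bound on Sink-or-Clash, an LP-feasible `x` is read as a behaviour strategy: having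
reached `H` with mass `w > 0`, query `P` with probability `x (H, P) / w`. The payoff sum then bounds
the expected number of queries (`LPFeasible.exists_randAlg`). The explicit solution `optSolution`
has value `46 / 17`. The same passage carries the lower bound for algorithms over to the linear
program, so no dual solution is needed. For Sink-USO, a uniform mixture of the twenty decision trees
`usoAlg v k` attains `43 / 20`. -/

/-- The queries in `R` solve Sink-or-Clash on `s`. -/
def Solved {n : ℕ} (R : List (Bits n)) (s : Outmap n) : Prop :=
  (∃ u ∈ R, s u = zeroBits n) ∨ ∃ u ∈ R, ∃ v ∈ R, Clash u (s u) v (s v)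

/-! ### Lower bounds from weighted families of outmaps -/

/-- The minimum of a list of naturals, `0` for the empty list. -/
def listMin : List ℕ → ℕ
  | [] => 0
  | [a] => a
  | a :: b :: l => min a (listMin (b :: l))

theorem listMin_le {a : ℕ} : ∀ {l : List ℕ}, a ∈ l → listMin l ≤ a
  | [b], h => by simp_all [listMin]
  | b :: c :: l, h => by
    rw [List.mem_cons] at h
    rcases h with rfl | h
    · exact min_le_left _ _
    · exact (min_le_right _ _).trans (listMin_le h)

section lower

variable {n : ℕ} (vals : List (Bits n)) (eqv : Bits n → Bits n → Bool)
  (solved : List (Bits n) → Outmap n → Bool)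

/-- The least weighted number of further queries, over the weighted outmaps in `L`, needed by an
algorithm that has queried `Q` and looks `k` queries ahead. The values in `vals` serve as vertices
and as answers. -/
def lowerVal : ℕ → List (Bits n) → List (ℕ × Outmap n) → ℕ
  | 0, _, _ => 0
  | _ + 1, _, [] => 0
  | k + 1, Q, p :: L =>
    bif (p :: L).any fun p => solved Q p.2 then 0 else
      listMin ((vals.filter fun v => !Q.any (eqv v)).map fun v =>
        ((p :: L).map Prod.fst).sum +
          (vals.map fun a => lowerVal k (v :: Q) ((p :: L).filter fun p => eqv (p.2 v) a)).sum)

variable {vals eqv solved}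

theorem lowerVal_nil (k : ℕ) (Q : List (Bits n)) : lowerVal vals eqv solved k Q [] = 0 := by
  cases k <;> rfl

/-- Every outmap falls into exactly one answer class, since `vals` lists each bitstring exactly
once. -/
theorem sum_filter_eq (hnd : vals.Nodup) (hmem : ∀ v, v ∈ vals)
    (heq : ∀ u v, eqv u v = true ↔ u = v) (v : Bits n)
    (f : Bits n → ℕ × Outmap n → ℕ) (L : List (ℕ × Outmap n)) :
    (vals.map fun a => ((L.filter fun p => eqv (p.2 v) a).map (f a)).sum).sum =
      (L.map fun p => f (p.2 v) p).sum := by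
  induction L with
  | nil => simp
  | cons p L ih =>
    have h1 : ∀ a, (((p :: L).filter fun p => eqv (p.2 v) a).map (f a)).sum =
        (if p.2 v = a then f a p else 0) +
          ((L.filter fun p => eqv (p.2 v) a).map (f a)).sum := by
      intro a
      by_cases h : p.2 v = a
      · subst h
        simp [(heq _ _).2 rfl]
      · have h' : eqv (p.2 v) a = false := by
          rw [← Bool.not_eq_true, heq]; exact h
        simp [h', h]
    simp only [h1, List.sum_map_add, ih, List.map_cons, List.sum_cons]
    congr 1
    classical
    rw [← List.sum_toFinset _ hnd, Finset.sum_ite_eq, if_pos]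
    simpa using hmem _

/-- The outmaps in `L` agree on `Q`, so the algorithm cannot yet tell them apart: its next query is
the same for all, and the answers split `L`. Halting is only possible once the outmaps are solved,
where the recursion gives `0`. Quantifying over all `R` containing the queries makes their order and
repetitions irrelevant. -/
theorem lowerVal_le (hnd : vals.Nodup) (hmem : ∀ v, v ∈ vals)
    (heq : ∀ u v, eqv u v = true ↔ u = v) (A : DetAlg n) :
    ∀ (k : ℕ) (Q : List (Bits n)) (L : List (ℕ × Outmap n)),
    (∀ q ∈ Q, ∀ p ∈ L, ∀ p' ∈ L, p.2 q = p'.2 q) →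
    (∀ p ∈ L, ∀ R : List (Bits n), Q ⊆ R → A.run p.2 ⊆ R → solved R p.2 = true) →
    lowerVal vals eqv solved k Q L ≤ (L.map fun p => p.1 * A.numQueries p.2).sum := by
  induction A with
  | halt =>
    intro k Q L _ hs
    match k, L with
    | 0, _ => simp [lowerVal]
    | k + 1, [] => simp [lowerVal]
    | k + 1, p :: L =>
      have := hs p (by simp) Q (List.Subset.refl _) (by simp [DetAlg.run])
      simp [lowerVal, this]
  | query v next ih =>
    intro k Q L hQ hs
    by_cases hv : v ∈ Q
    -- A repeated query has an answer common to all of `L`, so dropping it only lowers the cost.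
    · match L with
      | [] => simp [lowerVal_nil]
      | p :: L =>
        refine (ih (p.2 v) k Q (p :: L) hQ ?_).trans ?_
        · intro p' hp' R hR hA
          refine hs p' hp' R hR ?_
          rw [DetAlg.run, hQ v hv p' hp' p (by simp)]
          exact List.cons_subset.2 ⟨hR hv, hA⟩
        · refine List.sum_le_sum fun p' hp' => Nat.mul_le_mul_left _ ?_
          rw [DetAlg.numQueries, DetAlg.numQueries, DetAlg.run,
            hQ v hv p' hp' p (by simp), List.length_cons]
          exact Nat.le_succ _
    · match k, L with
      | 0, _ => simp [lowerVal]
      | k + 1, [] => simp [lowerVal]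
      | k + 1, p :: L =>
        rw [lowerVal]
        generalize p :: L = L at *
        cases hany : L.any fun p => solved Q p.2
        · rw [cond_false]
          refine (listMin_le (List.mem_map.2 ⟨v, ?_, rfl⟩)).trans ?_
          · simp only [List.mem_filter, hmem, true_and, Bool.not_eq_true', List.any_eq_false]
            intro q hq h
            exact hv ((heq _ _).1 h ▸ hq)
          · have hnum : ∀ p : ℕ × Outmap n, p.1 * (DetAlg.query v next).numQueries p.2 =
                p.1 + p.1 * (next (p.2 v)).numQueries p.2 := by
              intro p
              rw [DetAlg.numQueries, DetAlg.run, List.length_cons, DetAlg.numQueries]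
              ring
            simp only [hnum, List.sum_map_add]
            refine Nat.add_le_add_left ?_ _
            rw [← sum_filter_eq hnd hmem heq v fun a p => p.1 * (next a).numQueries p.2]
            refine List.sum_le_sum fun a _ => ih a k (v :: Q) _ ?_ ?_
            · intro q hq p hp p' hp'
              simp only [List.mem_filter, heq] at hp hp'
              rcases List.mem_cons.1 hq with rfl | hq
              · rw [hp.2, hp'.2]
              · exact hQ q hq p hp.1 p' hp'.1
            · intro p hp R hR hA
              simp only [List.mem_filter, heq] at hp
              refine hs p hp.1 R (fun q hq => hR (List.mem_cons_of_mem _ hq)) ?_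
              rw [DetAlg.run, hp.2]
              exact List.cons_subset.2 ⟨hR List.mem_cons_self, hA⟩
        · simp

/-- A weighted family of outmaps bounds the worst-case expected number of queries from below. -/
theorem lowerVal_le_of_expectedQueries_le (hnd : vals.Nodup) (hmem : ∀ v, v ∈ vals)
    (heq : ∀ u v, eqv u v = true ↔ u = v) (μ : RandAlg n) (k : ℕ) (L : List (ℕ × Outmap n))
    (hs : ∀ A ∈ μ.support, ∀ p ∈ L, ∀ R : List (Bits n), A.run p.2 ⊆ R → solved R p.2 = true)
    {c : ℝ≥0∞} (hc : ∀ p ∈ L, μ.expectedQueries p.2 ≤ c) :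
    (lowerVal vals eqv solved k [] L : ℝ≥0∞) ≤ ((L.map Prod.fst).sum : ℕ) * c := by
  have key : ∀ L : List (ℕ × Outmap n), (∀ p ∈ L, μ.expectedQueries p.2 ≤ c) →
      ∑' A, μ A * ((L.map fun p => p.1 * A.numQueries p.2).sum : ℕ) ≤
        ((L.map Prod.fst).sum : ℕ) * c := by
    intro L
    induction L with
    | nil => simp
    | cons p L ih =>
      intro h
      have h1 := ih fun q hq => h q (List.mem_cons_of_mem _ hq)
      have h2 := mul_le_mul_right (h p List.mem_cons_self) (p.1 : ℝ≥0∞)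
      simp only [List.map_cons, List.sum_cons, Nat.cast_add, Nat.cast_mul, mul_add, add_mul]
      rw [ENNReal.tsum_add]
      refine add_le_add ?_ h1
      rw [RandAlg.expectedQueries, ← ENNReal.tsum_mul_left] at h2
      refine le_trans (le_of_eq (tsum_congr fun A => ?_)) h2
      ring
  refine le_trans ?_ (key L hc)
  -- As `μ` has total mass one, the bound may be compared algorithm by algorithm.
  rw [← one_mul ((lowerVal vals eqv solved k [] L : ℕ) : ℝ≥0∞), ← μ.tsum_coe,
    ← ENNReal.tsum_mul_right]
  refine ENNReal.tsum_le_tsum fun A => ?_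
  by_cases hA : A ∈ μ.support
  · refine mul_le_mul_right (Nat.cast_le.2 ?_) _
    exact lowerVal_le hnd hmem heq A k [] L (by simp) fun p hp R _ hR => hs A hA p hp R hR
  · rw [PMF.mem_support_iff, not_not] at hA
    simp [hA]

end lower

/-! ### Expectations -/

theorem tsum_bind_mul {α β : Type*} (p : PMF α) (q : α → PMF β) (f : β → ℝ≥0∞) :
    ∑' b, p.bind q b * f b = ∑' a, p a * ∑' b, q a b * f b := by
  simp only [PMF.bind_apply, ← ENNReal.tsum_mul_right, ← ENNReal.tsum_mul_left]
  rw [ENNReal.tsum_comm]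
  simp only [mul_assoc]

theorem tsum_pure_mul {α : Type*} (a : α) (f : α → ℝ≥0∞) :
    ∑' b, PMF.pure a b * f b = f a := by
  rw [tsum_eq_single a]
  · simp
  · intro b hb
    simp [PMF.pure_apply_of_ne _ _ hb]

theorem tsum_map_mul {α β : Type*} (p : PMF α) (g : α → β) (f : β → ℝ≥0∞) :
    ∑' b, p.map g b * f b = ∑' a, p a * f (g a) := by
  rw [← PMF.bind_pure_comp, tsum_bind_mul]
  simp only [Function.comp, tsum_pure_mul]

/-- Finitely many distributions are the marginals of a joint distribution. -/
theorem exists_pmf_map_eval_eq {ι α : Type*} [Finite ι] (m : ι → PMF α) :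
    ∃ ν : PMF (ι → α), ∀ i, ν.map (fun f => f i) = m i := by
  classical
  cases nonempty_fintype ι
  suffices h : ∀ t : Finset ι, ∃ ν : PMF (ι → α), ∀ i ∈ t, ν.map (fun f => f i) = m i by
    obtain ⟨ν, hν⟩ := h Finset.univ
    exact ⟨ν, fun i => hν i (Finset.mem_univ i)⟩
  intro t
  induction t using Finset.induction_on with
  | empty =>
    exact ⟨PMF.pure fun i => (m i).support_nonempty.some, by simp⟩
  | insert i t hi ih =>
    obtain ⟨ν, hν⟩ := ih
    -- Resampling coordinate `i` independently from `m i` leaves the other marginals unchanged.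
    refine ⟨ν.bind fun f => (m i).map fun a => Function.update f i a, fun j hj => ?_⟩
    rw [PMF.map_bind]
    simp only [PMF.map_comp]
    by_cases hij : j = i
    · subst hij
      have h : ∀ f : ι → α, ((fun g : ι → α => g j) ∘ fun a => Function.update f j a) = id := by
        intro f; ext a; simp
      simp only [h, PMF.map_id, PMF.bind_const]
    · have h : ∀ f : ι → α, ((fun g : ι → α => g j) ∘ fun a => Function.update f i a) =
          Function.const α (f j) := by
        intro f; ext a; simp [hij]
      simp only [h, PMF.map_const]
      rw [← hν j ((Finset.mem_insert.1 hj).resolve_left hij), ← PMF.bind_pure_comp]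
      rfl

/-! ### The payoff above a history -/

theorem payoff_eq_zero {n : ℕ} {S : Sequence n} {s : Outmap n}
    (h : ¬ ∀ p ∈ S.1.1, s p.1 = p.2) : payoff S s = 0 :=
  if_neg fun h' => h h'.1

open Classical in
/-- The part of the payoff sum that stems from sequences whose history extends `H`. -/
noncomputable def payoffAbove {n : ℕ} (x : Sequence n → ℝ) (s : Outmap n)
    (H : List (Bits n × Bits n)) : ℝ :=
  ∑ S : Sequence n, if H <:+ S.1.1 then payoff S s * x S else 0

theorem payoffAbove_nil {n : ℕ} (x : Sequence n → ℝ) (s : Outmap n) :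
    payoffAbove x s [] = ∑ S : Sequence n, payoff S s * x S := by
  simp [payoffAbove]

theorem IsHistory.of_suffix {n : ℕ} {H H' : List (Bits n × Bits n)} (h : IsHistory H')
    (hs : H <:+ H') : IsHistory H :=
  ⟨fun p hp => h.1 p (hs.subset hp), h.2.sublist hs.sublist⟩

/-- A history above `H` is `H` itself or continues with an entry `(P, a)`; if `a ≠ s P`, the payoff
vanishes. -/
theorem payoffAbove_eq_sum {n : ℕ} (x : Sequence n → ℝ) (s : Outmap n) (H : History n) :
    payoffAbove x s H.1 = ∑ P : {P : Bits n // Unqueried H.1 P},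
      (payoff ⟨H, P⟩ s * x ⟨H, P⟩ + payoffAbove x s ((P.1, s P.1) :: H.1)) := by
  classical
  rw [Finset.sum_add_distrib]
  have h1 : ∑ P : {P : Bits n // Unqueried H.1 P}, payoff ⟨H, P⟩ s * x ⟨H, P⟩ =
      ∑ S : Sequence n, if S.1 = H then payoff S s * x S else 0 := by
    refine Fintype.sum_of_injective (fun P => (⟨H, P⟩ : Sequence n)) ?_ _ _ ?_ ?_
    · intro P P' h
      simpa using h
    · rintro ⟨H', P⟩ h
      rw [if_neg]
      rintro rfl
      exact h ⟨P, rfl⟩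
    · intro P
      simp
  rw [h1]
  simp only [payoffAbove]
  rw [Finset.sum_comm, ← Finset.sum_add_distrib]
  refine Finset.sum_congr rfl ?_
  rintro ⟨H', P⟩ -
  by_cases hs : ∀ p ∈ H'.1, s p.1 = p.2
  swap
  · simp [payoff_eq_zero (S := ⟨H', P⟩) hs]
  by_cases hH : H.1 <:+ H'.1
  · obtain ⟨l, hl⟩ := hH
    rcases List.eq_nil_or_concat l with rfl | ⟨l, p, rfl⟩
    · have hHH : H' = H := Subtype.ext (by simpa using hl.symm)
      subst hHH
      have : ∀ q : Bits n × Bits n, ¬ q :: H'.1 <:+ H'.1 := by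
        intro q h
        have := h.length_le
        simp at this
      simp [this]
    · have hl' : H'.1 = l ++ p :: H.1 := by simpa using hl.symm
      have hne : H' ≠ H := by
        rintro rfl
        have := congrArg List.length hl'
        simp at this
        omega
      have hp : IsHistory (p :: H.1) := H'.2.of_suffix ⟨l, hl'.symm⟩
      have hsp : s p.1 = p.2 := hs p (by simp [hl'])
      rw [if_pos ⟨l ++ [p], by simp [hl']⟩, if_neg hne, zero_add]
      rw [Finset.sum_eq_single ⟨p.1, hp.unqueried⟩]
      · rw [if_pos]
        simp only [hsp]
        exact ⟨l, hl'.symm⟩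
      · intro P' _ hP'
        rw [if_neg]
        rintro ⟨l', h⟩
        rw [hl'] at h
        apply hP'
        have := (List.append_inj' h (by simp)).2
        simp only [List.cons.injEq, and_true] at this
        exact Subtype.ext (congrArg Prod.fst this)
      · simp
  · have hne : H' ≠ H := by
      rintro rfl
      exact hH (List.suffix_refl _)
    have : ∀ q : Bits n × Bits n, ¬ q :: H.1 <:+ H'.1 := fun q h =>
      hH ((List.suffix_cons _ _).trans h)
    simp [hH, hne, this]

/-- Querying `P` after `H` reveals a sink or a clash. -/
def Finishes {n : ℕ} (H : List (Bits n × Bits n)) (P a : Bits n) : Prop :=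
  a = zeroBits n ∨ ∃ p ∈ H, Clash p.1 p.2 P a

theorem clash_comm {n : ℕ} {u a v b : Bits n} : Clash u a v b ↔ Clash v b u a := by
  simp only [Clash, ne_comm, Bool.xor_comm]

theorem isHistory_cons {n : ℕ} {H : List (Bits n × Bits n)} (hH : IsHistory H) {P a : Bits n}
    (hP : Unqueried H P) : IsHistory ((P, a) :: H) ↔ ¬ Finishes H P a := by
  constructor
  · rintro ⟨h1, h2⟩ (h | ⟨p, hp, hc⟩)
    · exact h1 _ List.mem_cons_self h
    · exact ((List.pairwise_cons.1 h2).1 p hp).2 (clash_comm.1 hc)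
  · intro h
    simp only [Finishes, not_or, not_exists, not_and] at h
    refine ⟨?_, List.pairwise_cons.2 ⟨fun p hp => ⟨(hP p hp).symm, fun hc => ?_⟩, hH.2⟩⟩
    · intro p hp
      rcases List.mem_cons.1 hp with rfl | hp
      · exact h.1
      · exact hH.1 p hp
    · exact h.2 p hp (clash_comm.1 hc)

theorem payoffAbove_eq_zero {n : ℕ} (x : Sequence n → ℝ) (s : Outmap n)
    {H : List (Bits n × Bits n)} (hH : ¬ IsHistory H) : payoffAbove x s H = 0 :=
  Finset.sum_eq_zero fun S _ => if_neg fun h => hH (S.1.2.of_suffix h)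

theorem payoff_of_finishes {n : ℕ} {H : History n} {s : Outmap n} (hs : ∀ p ∈ H.1, s p.1 = p.2)
    {P : {P : Bits n // Unqueried H.1 P}} (h : Finishes H.1 P.1 (s P.1)) :
    payoff ⟨H, P⟩ s = H.1.length + 1 :=
  if_pos ⟨hs, h⟩

theorem payoff_of_not_finishes {n : ℕ} {H : History n} {s : Outmap n}
    {P : {P : Bits n // Unqueried H.1 P}} (h : ¬ Finishes H.1 P.1 (s P.1)) :
    payoff ⟨H, P⟩ s = 0 :=
  if_neg fun h' => h h'.2

/-! ### From feasible solutions to randomized algorithms -/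

/-- Induction on the number of unqueried vertices. Here `w` is the mass with which `H` is reached,
and `μ` continues from `H`; the term `H.1.length` accounts for the queries already made, which the
payoff includes. -/
theorem exists_randAlg_of_history {n : ℕ} {x : Sequence n → ℝ} {v : ℝ} (hx : LPFeasible n x v)
    (k : ℕ) : ∀ (H : History n) (w : ℝ), {P | Unqueried H.1 P}.ncard ≤ k →
    ∑ P : {P : Bits n // Unqueried H.1 P}, x ⟨H, P⟩ = w → 0 < w →
    ∃ μ : RandAlg n, ∀ s : Outmap n, (∀ p ∈ H.1, s p.1 = p.2) →
      (∀ A ∈ μ.support, ∀ R : List (Bits n), (∀ p ∈ H.1, p.1 ∈ R) → A.run s ⊆ R → Solved R s) ∧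
      ENNReal.ofReal w * (H.1.length + μ.expectedQueries s) ≤
        ENNReal.ofReal (payoffAbove x s H.1) := by
  have hF : ∀ s H, 0 ≤ payoffAbove x s H := by
    intro s H
    refine Finset.sum_nonneg fun S _ => ?_
    split_ifs
    · refine mul_nonneg ?_ (hx.nonneg S)
      rw [payoff]
      split_ifs <;> positivity
    · exact le_rfl
  induction k with
  | zero =>
    intro H w hk hw hpos
    rw [Nat.le_zero, Set.ncard_eq_zero (Set.toFinite _)] at hk
    have : IsEmpty {P : Bits n // Unqueried H.1 P} := ⟨fun P => by
      have : P.1 ∈ {P | Unqueried H.1 P} := P.2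
      rw [hk] at this
      exact this⟩
    rw [Finset.univ_eq_empty, Finset.sum_empty] at hw
    exact absurd hw hpos.ne
  | succ k ih =>
    intro H w hk hw hpos
    have step : ∀ (P : {P : Bits n // Unqueried H.1 P}) (a : Bits n), ∃ μ : RandAlg n,
        0 < x ⟨H, P⟩ → ∀ s : Outmap n, (∀ p ∈ H.1, s p.1 = p.2) → s P.1 = a →
        (∀ A ∈ μ.support, ∀ R : List (Bits n), (∀ p ∈ H.1, p.1 ∈ R) → P.1 ∈ R → A.run s ⊆ R →
          Solved R s) ∧
        ENNReal.ofReal (x ⟨H, P⟩) * (H.1.length + (1 + μ.expectedQueries s)) ≤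
          ENNReal.ofReal (payoff ⟨H, P⟩ s * x ⟨H, P⟩ + payoffAbove x s ((P.1, a) :: H.1)) := by
      intro P a
      by_cases hfin : Finishes H.1 P.1 a
      · refine ⟨PMF.pure .halt, fun hxP s hs hsa => ⟨?_, ?_⟩⟩
        · intro A _ R hR hPR _
          rcases hfin with h | ⟨p, hp, hc⟩
          · exact Or.inl ⟨P.1, hPR, hsa.trans h⟩
          · refine Or.inr ⟨p.1, hR p hp, P.1, hPR, ?_⟩
            rw [hs p hp, hsa]
            exact hc
        · subst hsa
          rw [payoff_of_finishes hs hfin, payoffAbove_eq_zero x s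
            (mt (isHistory_cons H.2 P.2).1 (not_not.2 hfin)), add_zero,
            ENNReal.ofReal_mul (by positivity), mul_comm]
          refine le_of_eq ?_
          congr 1
          rw [RandAlg.expectedQueries, tsum_pure_mul, ENNReal.ofReal_add (by positivity) (by simp)]
          simp [DetAlg.numQueries, DetAlg.run]
      · by_cases hxP : 0 < x ⟨H, P⟩
        · have hH' : IsHistory ((P.1, a) :: H.1) := (isHistory_cons H.2 P.2).2 hfin
          have hcard : {Q | Unqueried ((P.1, a) :: H.1) Q}.ncard ≤ k := by
            refine Nat.le_of_lt_succ (lt_of_lt_of_le (Set.ncard_lt_ncard ?_ (Set.toFinite _)) hk)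
            refine ⟨fun Q hQ p hp => hQ p (List.mem_cons_of_mem _ hp), fun h => ?_⟩
            exact h P.2 (P.1, a) List.mem_cons_self rfl
          obtain ⟨μ, hμ⟩ := ih ⟨_, hH'⟩ (x ⟨H, P⟩) hcard (hx.sum_cons _ _ hH') hxP
          refine ⟨μ, fun _ s hs hsa => ?_⟩
          obtain ⟨h1, h2⟩ := hμ s (by simpa [hsa] using hs)
          refine ⟨?_, ?_⟩
          · intro A hA R hR hPR hAR
            exact h1 A hA R (by simpa [hPR] using hR) hAR
          · subst hsa
            rw [payoff_of_not_finishes hfin, zero_mul, zero_add]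
            refine le_trans (le_of_eq ?_) h2
            simp [add_assoc]
        -- Branches of zero mass are never entered, so any continuation will do.
        · exact ⟨PMF.pure .halt, fun h => absurd h hxP⟩
    choose m hm using step
    -- A decision tree fixes a continuation for every answer at once, so the continuations `m P a`
    -- are drawn jointly; only their marginals affect the cost.
    choose ν hν using fun P => exists_pmf_map_eval_eq (m P)
    have hsum : ∑ P : {P : Bits n // Unqueried H.1 P}, ENNReal.ofReal (x ⟨H, P⟩ / w) = 1 := by
      rw [← ENNReal.ofReal_sum_of_nonneg fun P _ => div_nonneg (hx.nonneg _) hpos.le,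
        ← Finset.sum_div, hw, div_self hpos.ne', ENNReal.ofReal_one]
    refine ⟨(PMF.ofFintype _ hsum).bind fun P => (ν P).map (DetAlg.query P.1), ?_⟩
    intro s hs
    refine ⟨?_, ?_⟩
    · intro A hA R hR hAR
      rw [PMF.mem_support_bind_iff] at hA
      obtain ⟨P, hP, hA⟩ := hA
      rw [PMF.mem_support_map_iff] at hA
      obtain ⟨f, hf, rfl⟩ := hA
      rw [PMF.mem_support_ofFintype_iff, ne_eq, ENNReal.ofReal_eq_zero, not_le] at hP
      have hxP : 0 < x ⟨H, P⟩ := (div_pos_iff_of_pos_right hpos).1 hP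
      rw [DetAlg.run, List.cons_subset] at hAR
      refine (hm P (s P.1) hxP s hs rfl).1 (f (s P.1)) ?_ R hR hAR.1 hAR.2
      rw [← hν, PMF.mem_support_map_iff]
      exact ⟨f, hf, rfl⟩
    · have hE : ∀ P, ∑' A, ((ν P).map (DetAlg.query P.1)) A * (A.numQueries s : ℝ≥0∞) =
          1 + (m P (s P.1)).expectedQueries s := by
        intro P
        rw [tsum_map_mul, ← hν, RandAlg.expectedQueries, tsum_map_mul]
        conv_rhs => rw [← (ν P).tsum_coe, ← ENNReal.tsum_add]
        refine tsum_congr fun f => ?_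
        rw [DetAlg.numQueries, DetAlg.run, List.length_cons, DetAlg.numQueries]
        push_cast
        ring
      rw [RandAlg.expectedQueries, tsum_bind_mul, tsum_fintype]
      simp only [hE, PMF.ofFintype_apply]
      rw [payoffAbove_eq_sum, ENNReal.ofReal_sum_of_nonneg]
      · have h1 : (H.1.length : ℝ≥0∞) = ∑ P : {P : Bits n // Unqueried H.1 P},
            ENNReal.ofReal (x ⟨H, P⟩ / w) * H.1.length := by
          rw [← Finset.sum_mul, hsum, one_mul]
        rw [h1, ← Finset.sum_add_distrib, Finset.mul_sum]
        refine Finset.sum_le_sum fun P _ => ?_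
        rw [← mul_add, ← mul_assoc, ← ENNReal.ofReal_mul hpos.le, mul_div_cancel₀ _ hpos.ne']
        by_cases hxP : 0 < x ⟨H, P⟩
        · exact (hm P (s P.1) hxP s hs rfl).2
        · rw [ENNReal.ofReal_eq_zero.2 (not_lt.1 hxP), zero_mul]
          exact zero_le
      · intro P _
        refine add_nonneg (mul_nonneg ?_ (hx.nonneg _)) (hF _ _)
        rw [payoff]
        split_ifs <;> positivity

/-- A feasible solution of the linear program yields a randomized algorithm of the same value. -/
theorem LPFeasible.exists_randAlg {n : ℕ} {x : Sequence n → ℝ} {v : ℝ} (hx : LPFeasible n x v) :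
    ∃ μ : RandAlg n, μ.SolvesSinkOrClash ∧ ∀ s, μ.expectedQueries s ≤ ENNReal.ofReal v := by
  obtain ⟨μ, hμ⟩ := exists_randAlg_of_history hx _ (History.empty n) 1 le_rfl hx.sum_empty one_pos
  refine ⟨μ, fun A hA s => ?_, fun s => ?_⟩
  · exact (hμ s (by simp [History.empty])).1 A hA (A.run s) (by simp [History.empty])
      (List.Subset.refl _)
  · have h := (hμ s (by simp [History.empty])).2
    simp only [History.empty, List.length_nil, Nat.cast_zero, zero_add, ENNReal.ofReal_one,
      one_mul, payoffAbove_nil] at h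
    exact h.trans (ENNReal.ofReal_le_ofReal (hx.payoff_le s))

/-! ### Computing on the 2-cube -/

/-- The bitstrings of length two. -/
def allBits : List (Bits 2) := [![false, false], ![true, false], ![false, true], ![true, true]]

/-- Boolean equality of bitstrings of length two. -/
def eqBits (u v : Bits 2) : Bool := u 0 == v 0 && u 1 == v 1

theorem eqBits_iff (u v : Bits 2) : eqBits u v = true ↔ u = v := by
  simp [eqBits, funext_iff, Fin.forall_fin_two]

theorem eqBits_eq_false_iff (u v : Bits 2) : eqBits u v = false ↔ u ≠ v := by
  rw [← Bool.not_eq_true, eqBits_iff]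

theorem allBits_nodup : allBits.Nodup := by decide

theorem mem_allBits (u : Bits 2) : u ∈ allBits := by
  have h : ∀ u : Bits 2, u ∈ allBits := by decide
  exact h u

/-- Boolean version of `Clash` on the 2-cube. -/
def clashBits (u a v b : Bits 2) : Bool :=
  !eqBits u v && !(xor (a 0) (b 0) && xor (u 0) (v 0)) && !(xor (a 1) (b 1) && xor (u 1) (v 1))

theorem clashBits_iff (u a v b : Bits 2) : clashBits u a v b = true ↔ Clash u a v b := by
  rw [clashBits, Clash, Bool.and_eq_true, Bool.and_eq_true, Bool.not_eq_true', Bool.not_eq_true',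
    Bool.not_eq_true', eqBits_eq_false_iff, funext_iff, Fin.forall_fin_two, and_assoc]
  rfl

/-- The sum of two bitstrings of length two. -/
def addBits (u v : Bits 2) : Bits 2 := ![xor (u 0) (v 0), xor (u 1) (v 1)]

/-- The bitstring `11`. -/
def ones : Bits 2 := ![true, true]

/-- The outmap on the 2-cube with the given values at `00`, `10`, `01`, `11`. -/
def mkOutmap (a b c d : Bits 2) : Outmap 2 := fun u =>
  bif u 1 then bif u 0 then d else c else bif u 0 then b else a

theorem eq_mkOutmap (s : Outmap 2) : s = mkOutmap (s ![false, false]) (s ![true, false])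
    (s ![false, true]) (s ![true, true]) := by
  funext u
  have hu : u = ![u 0, u 1] := by
    ext i
    fin_cases i <;> rfl
  rw [hu]
  generalize u 0 = a
  generalize u 1 = b
  cases a <;> cases b <;> rfl

theorem forall_outmap {p : Outmap 2 → Prop}
    (h : ∀ a ∈ allBits, ∀ b ∈ allBits, ∀ c ∈ allBits, ∀ d ∈ allBits, p (mkOutmap a b c d))
    (s : Outmap 2) : p s := by
  rw [eq_mkOutmap s]
  exact h _ (mem_allBits _) _ (mem_allBits _) _ (mem_allBits _) _ (mem_allBits _)

/-- Boolean test whether a vertex has been queried. -/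
def queried (H : List (Bits 2 × Bits 2)) (P : Bits 2) : Bool := H.any fun p => eqBits p.1 P

theorem queried_eq_false_iff (H : List (Bits 2 × Bits 2)) (P : Bits 2) :
    queried H P = false ↔ Unqueried H P := by
  simp [queried, Unqueried, List.any_eq_false, eqBits_iff]

theorem sum_unqueried {M : Type*} [AddCommMonoid M] (H : List (Bits 2 × Bits 2))
    (f : Bits 2 → M) : ∑ P : {P : Bits 2 // Unqueried H P}, f P.1 =
      (allBits.map fun P => bif queried H P then 0 else f P).sum := by
  classical
  have h1 : allBits.toFinset = Finset.univ := by
    ext u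
    simp [mem_allBits]
  rw [← List.sum_toFinset _ allBits_nodup, h1,
    ← Finset.sum_subtype (Finset.univ.filter (Unqueried H)) (by simp) f, Finset.sum_filter]
  refine Finset.sum_congr rfl fun P _ => ?_
  cases h : queried H P
  · rw [if_pos ((queried_eq_false_iff H P).1 h), cond_false]
  · rw [if_neg, cond_true]
    rw [← queried_eq_false_iff, h]
    simp

/-- A history does not query all vertices. -/
theorem IsHistory.exists_unqueried {n : ℕ} {H : List (Bits n × Bits n)} (hH : IsHistory H) :
    ∃ P, Unqueried H P := by
  by_contra! h
  simp only [Unqueried, not_forall, not_not] at h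
  choose p hp hpP using h
  have hsymm : Std.Symm fun q q' : Bits n × Bits n => q.1 ≠ q'.1 ∧ ¬ Clash q.1 q.2 q'.1 q'.2 :=
    ⟨fun q q' h => ⟨h.1.symm, fun hc => h.2 (clash_comm.1 hc)⟩⟩
  have hpair := hH.2.forall
  -- Distinct vertices with equal values clash. Were all vertices queried, the values would form a
  -- bijection, and `0` would be among them.
  have hinj : Function.Injective fun P => (p P).2 := by
    intro P P' heq
    by_contra hne
    have hne' : p P ≠ p P' := fun h => hne (by rw [← hpP P, ← hpP P', h])
    refine (hpair (hp P) (hp P') hne').2 ⟨by rwa [hpP, hpP], ?_⟩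
    funext i
    have : (p P).2 i = (p P').2 i := congrFun heq i
    simp [this, zeroBits]
  obtain ⟨P, hP⟩ := Finite.injective_iff_surjective.1 hinj (zeroBits n)
  exact hH.1 _ (hp P) hP

theorem IsHistory.length_lt {n : ℕ} {H : List (Bits n × Bits n)} (hH : IsHistory H) :
    H.length < 2 ^ n := by
  classical
  obtain ⟨P, hP⟩ := hH.exists_unqueried
  have hnd : (H.map Prod.fst).Nodup := List.pairwise_map.2 (hH.2.imp fun h => h.1)
  have h1 : (H.map Prod.fst).toFinset ⊂ Finset.univ := by
    refine Finset.ssubset_univ_iff.2 fun h => ?_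
    have := Finset.mem_univ P
    rw [← h, List.mem_toFinset, List.mem_map] at this
    obtain ⟨p, hp, h⟩ := this
    exact hP p hp h
  have h2 := Finset.card_lt_card h1
  rw [List.toFinset_card_of_nodup hnd] at h2
  simpa using h2

/-! ### An optimal solution of the linear program -/

/-- The edge at `u` in the only outgoing direction leads to `P`. -/
def pointsTo (p : Bits 2 × Bits 2) (P : Bits 2) : Bool :=
  !eqBits p.2 ones && eqBits P (addBits p.1 p.2)

/-- The weight of the second query. -/
def weightTwo (p : Bits 2 × Bits 2) (P : Bits 2) : ℕ :=
  bif eqBits P (addBits p.1 ones) then bif eqBits p.2 ones then 9 else 5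
  else bif eqBits p.2 ones then 4 else bif pointsTo p P then 12 else 0

/-- The weight of the third query. -/
def weightThree (q p : Bits 2 × Bits 2) (P : Bits 2) : ℕ :=
  bif pointsTo q P || pointsTo p P then weightTwo p q.1 else 0

/-- An optimal solution of the linear program for the 2-cube, multiplied by `68`. -/
def weight : List (Bits 2 × Bits 2) → Bits 2 → ℕ
  | [], _ => 17
  | [p], P => weightTwo p P
  | [q, p], P => weightThree q p P
  | [r, q, p], _ => weightThree q p r.1
  | _, _ => 0

/-- Conservation of mass: `17 = 9 + 4 + 4` after the answer `11`, and `17 = 5 + 12` after an answer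
with one outgoing edge. -/
theorem sum_weight_one : ∀ u ∈ allBits, ∀ a ∈ allBits, eqBits a ![false, false] = false →
    (allBits.map fun P => bif queried [(u, a)] P then 0 else weight [(u, a)] P).sum = 17 := by
  decide +kernel

/-- If the second query has positive weight, exactly one of the two remaining vertices is pointed
to, and it receives all the mass. -/
theorem sum_weight_two : ∀ u ∈ allBits, ∀ a ∈ allBits, ∀ v ∈ allBits, ∀ b ∈ allBits,
    eqBits a ![false, false] = false → eqBits b ![false, false] = false →
    eqBits u v = false → clashBits u a v b = false →
    (allBits.map fun P =>
      bif queried [(u, a), (v, b)] P then 0 else weight [(u, a), (v, b)] P).sum =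
      weightTwo (v, b) u := by
  decide +kernel

theorem sum_weight_three (c : ℕ) (x y z : Bits 2) : ∀ u ∈ allBits, ∀ v ∈ allBits, ∀ w ∈ allBits,
    u ≠ v → u ≠ w → v ≠ w →
    (allBits.map fun P => bif queried [(u, x), (v, y), (w, z)] P then 0 else c).sum = c := by
  have h : ∀ u ∈ allBits, ∀ v ∈ allBits, ∀ w ∈ allBits, u ≠ v → u ≠ w → v ≠ w →
      (allBits.filter fun P => !(eqBits u P || (eqBits v P || (eqBits w P || false)))).length
        = 1 := by
    decide +kernel
  intro u hu v hv w hw h1 h2 h3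
  have key : ∀ (l : List (Bits 2)) (q : Bits 2 → Bool),
      (l.map fun P => bif q P then 0 else c).sum = (l.filter fun P => !q P).length * c := by
    intro l q
    induction l with
    | nil => simp
    | cons P l ih => cases hq : q P <;> simp [ih, hq, add_mul, add_comm]
  rw [key]
  have := h u hu v hv w hw h1 h2 h3
  simp only [queried, List.any_cons, List.any_nil]
  rw [this, one_mul]

theorem sum_weight_cons (p : Bits 2 × Bits 2) (H : List (Bits 2 × Bits 2))
    (h : IsHistory (p :: H)) :
    (allBits.map fun P => bif queried (p :: H) P then 0 else weight (p :: H) P).sum =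
      weight H p.1 := by
  have hz : ∀ a : Bits 2, a ≠ zeroBits 2 → eqBits a ![false, false] = false := by
    intro a ha
    rw [eqBits_eq_false_iff]
    rintro rfl
    apply ha
    funext i
    fin_cases i <;> rfl
  have hlen := h.length_lt
  match H with
  | [] =>
    exact sum_weight_one _ (mem_allBits _) _ (mem_allBits _) (hz _ (h.1 p (by simp)))
  | [q] =>
    have hpq := (List.pairwise_cons.1 h.2).1 q (by simp)
    exact sum_weight_two _ (mem_allBits _) _ (mem_allBits _) _ (mem_allBits _) _ (mem_allBits _)
      (hz _ (h.1 p (by simp))) (hz _ (h.1 q (by simp))) ((eqBits_eq_false_iff _ _).2 hpq.1)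
      (by rw [← Bool.not_eq_true, clashBits_iff]; exact hpq.2)
  | [q, r] =>
    have hp := (List.pairwise_cons.1 h.2).1
    have hq := (List.pairwise_cons.1 h.tail.2).1
    exact sum_weight_three _ _ _ _ _ (mem_allBits _) _ (mem_allBits _) _ (mem_allBits _)
      (hp q (by simp)).1 (hp r (by simp)).1 (hq r (by simp)).1
  | _ :: _ :: _ :: _ =>
    simp at hlen
    omega

/-- Boolean version of `Finishes` on the 2-cube. -/
def finishes (H : List (Bits 2 × Bits 2)) (P a : Bits 2) : Bool :=
  eqBits a ![false, false] || H.any fun p => clashBits p.1 p.2 P a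

theorem zeroBits_two : zeroBits 2 = ![false, false] := by
  funext i
  fin_cases i <;> rfl

theorem finishes_iff (H : List (Bits 2 × Bits 2)) (P a : Bits 2) :
    finishes H P a = true ↔ Finishes H P a := by
  simp [finishes, Finishes, eqBits_iff, clashBits_iff, zeroBits_two]

/-- The payoff sum above a history, with `k` more queries, multiplied by `68`. -/
def scaledPayoff (s : Outmap 2) : ℕ → List (Bits 2 × Bits 2) → ℕ
  | 0, _ => 0
  | k + 1, H => (allBits.map fun P => bif queried H P then 0 else
      bif finishes H P (s P) then (H.length + 1) * weight H P
      else scaledPayoff s k ((P, s P) :: H)).sum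

/-- The optimal solution of the linear program for the 2-cube. -/
noncomputable def optSolution (S : Sequence 2) : ℝ := weight S.1.1 S.2.1 / 68

theorem payoffAbove_optSolution (s : Outmap 2) (k : ℕ) :
    ∀ H : List (Bits 2 × Bits 2), IsHistory H → (∀ p ∈ H, s p.1 = p.2) → 4 ≤ k + H.length →
    payoffAbove optSolution s H = scaledPayoff s k H / 68 := by
  induction k with
  | zero =>
    intro H hH _ hk
    have := hH.length_lt
    -- With no query left, the history would have four entries, one for every vertex.
    omega
  | succ k ih =>
    intro H hH hs hk
    rw [payoffAbove_eq_sum optSolution s ⟨H, hH⟩]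
    have h : ∀ P : {P : Bits 2 // Unqueried H P},
        payoff ⟨⟨H, hH⟩, P⟩ s * optSolution ⟨⟨H, hH⟩, P⟩ +
          payoffAbove optSolution s ((P.1, s P.1) :: H) =
        ((bif finishes H P.1 (s P.1) then (H.length + 1) * weight H P.1
          else scaledPayoff s k ((P.1, s P.1) :: H) : ℕ) : ℝ) / 68 := by
      intro P
      by_cases hf : Finishes H P.1 (s P.1)
      · rw [payoff_of_finishes hs hf, payoffAbove_eq_zero optSolution s
          (mt (isHistory_cons hH P.2).1 (not_not.2 hf)), (finishes_iff _ _ _).2 hf, cond_true,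
          optSolution]
        push_cast
        ring
      · have hf' : finishes H P.1 (s P.1) = false := by
          rw [← Bool.not_eq_true, finishes_iff]
          exact hf
        rw [payoff_of_not_finishes hf, hf', cond_false, zero_mul, zero_add]
        refine ih _ ((isHistory_cons hH P.2).2 hf) (by simpa using hs) ?_
        rw [List.length_cons]
        omega
    refine (Finset.sum_congr rfl fun P _ => h P).trans ?_
    rw [← Finset.sum_div, ← Nat.cast_sum, sum_unqueried H fun P =>
      bif finishes H P (s P) then (H.length + 1) * weight H P
        else scaledPayoff s k ((P, s P) :: H)]
    rfl

/-- The bound is `184 = 68 * (46 / 17)`. -/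
theorem scaledPayoff_le : ∀ a ∈ allBits, ∀ b ∈ allBits, ∀ c ∈ allBits, ∀ d ∈ allBits,
    scaledPayoff (mkOutmap a b c d) 4 [] ≤ 184 := by
  decide +kernel

theorem lpFeasible_optSolution : LPFeasible 2 optSolution (46 / 17) where
  payoff_le s := by
    rw [← payoffAbove_nil, payoffAbove_optSolution s 4 [] (History.empty 2).2 (by simp) (by simp)]
    have h : (scaledPayoff s 4 [] : ℝ) ≤ 184 := by
      exact_mod_cast forall_outmap (p := fun s => scaledPayoff s 4 [] ≤ 184) scaledPayoff_le s
    linarith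
  sum_empty := by
    simp only [optSolution]
    rw [← Finset.sum_div, ← Nat.cast_sum,
      sum_unqueried (History.empty 2).1 fun P => weight (History.empty 2).1 P]
    have : (allBits.map fun P => bif queried (History.empty 2).1 P then 0 else
        weight (History.empty 2).1 P).sum = 68 := by decide
    rw [this]
    norm_num
  sum_cons p H h := by
    simp only [optSolution]
    rw [← Finset.sum_div, ← Nat.cast_sum, sum_unqueried (p :: H) fun P => weight (p :: H) P,
      sum_weight_cons p H h]
    rfl
  nonneg S := by
    unfold optSolution
    positivity

/-! ### An optimal algorithm for Sink-USO on the 2-cube -/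

/-- The second query of the Sink-USO algorithm with seed `k` after the answer `a` at `v`. -/
def secondQuery (k : Fin 5) (v a : Bits 2) : Bits 2 :=
  bif eqBits a ones then
    addBits v (bif k == 0 then ones else bif k == 1 || k == 2 then ![true, false]
      else ![false, true])
  else addBits v a

/-- The third query of the Sink-USO algorithm after the answers `a` at `v` and `b` at `w`. -/
def thirdQuery (v a w b : Bits 2) : Bits 2 :=
  bif eqBits a ones && !eqBits (addBits v w) ones then addBits w ones else addBits w b

/-- The Sink-USO algorithm with first query `v` and seed `k`. -/
def usoAlg (v : Bits 2) (k : Fin 5) : DetAlg 2 :=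
  .query v fun a => bif eqBits a ![false, false] then .halt else
    .query (secondQuery k v a) fun b => bif eqBits b ![false, false] then .halt else
      .query (thirdQuery v a (secondQuery k v a) b) fun c =>
        bif eqBits c ![false, false] then .halt else
          -- The four vertices sum to zero, so the sum of three of them is the fourth.
          .query (addBits (addBits v (secondQuery k v a))
            (thirdQuery v a (secondQuery k v a) b)) fun _ => .halt

/-- Boolean version of `IsUSO` on the 2-cube. -/
def usoBits (s : Outmap 2) : Bool :=
  (allBits.all fun u => xor (s (addBits u ![true, false]) 0) (s u 0) &&
    xor (s (addBits u ![false, true]) 1) (s u 1)) &&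
    (allBits.filter fun u => eqBits (s u) ![false, false]).length == 1

theorem flipBit_zero (u : Bits 2) : flipBit u 0 = addBits u ![true, false] := by
  funext i
  fin_cases i <;> simp [flipBit, addBits]

theorem flipBit_one (u : Bits 2) : flipBit u 1 = addBits u ![false, true] := by
  funext i
  fin_cases i <;> simp [flipBit, addBits]

/-- This implication suffices: the algorithm is checked on all outmaps that pass the Boolean test.
-/
theorem IsUSO.usoBits {s : Outmap 2} (h : IsUSO s) : usoBits s = true := by
  rw [SinkOrClash.usoBits, Bool.and_eq_true, List.all_eq_true, beq_iff_eq]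
  constructor
  · intro u _
    have h0 := h.1 u 0
    have h1 := h.1 u 1
    rw [flipBit_zero] at h0
    rw [flipBit_one] at h1
    simp [h0, h1]
  · obtain ⟨v, hv, huniq⟩ := h.2 (zeroBits 2) Finset.univ
    have hv' : s v = ![false, false] := by
      rw [← zeroBits_two]
      funext i
      exact hv.2 i (Finset.mem_univ i)
    have : (allBits.filter fun u => eqBits (s u) ![false, false]) =
        allBits.filter fun u => u == v := by
      refine List.filter_congr fun u _ => ?_
      rw [Bool.eq_iff_iff, eqBits_iff, beq_iff_eq]
      constructor
      · intro hu
        refine huniq u ⟨by simp [face], fun i _ => ?_⟩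
        rw [hu, ← zeroBits_two]
        rfl
      · rintro rfl
        exact hv'
    rw [this, ← List.countP_eq_length_filter]
    exact List.count_eq_one_of_mem allBits_nodup (mem_allBits v)

theorem usoAlg_correct : ∀ a ∈ allBits, ∀ b ∈ allBits, ∀ c ∈ allBits, ∀ d ∈ allBits,
    usoBits (mkOutmap a b c d) = true → ∀ v ∈ allBits, ∀ k,
      (((usoAlg v k).run (mkOutmap a b c d)).any
        fun u => eqBits (mkOutmap a b c d u) ![false, false]) = true := by
  decide +kernel

/-- Summed over four starting vertices and five seeds, `43` queries give the average `43 / 20`. The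
seeds realize the probabilities `1/5, 2/5, 2/5` for the antipode and the two neighbours after the
answer `11`. -/
theorem usoAlg_numQueries : ∀ a ∈ allBits, ∀ b ∈ allBits, ∀ c ∈ allBits, ∀ d ∈ allBits,
    usoBits (mkOutmap a b c d) = true →
      (allBits.map fun v => ((List.finRange 5).map fun k =>
        (usoAlg v k).numQueries (mkOutmap a b c d)).sum).sum ≤ 43 := by
  decide +kernel

theorem exists_randAlg_sinkUSO : ∃ μ : RandAlg 2, μ.SolvesSinkUSO ∧
    ∀ s, IsUSO s → μ.expectedQueries s ≤ 43 / 20 := by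
  refine ⟨(PMF.uniformOfFintype (Bits 2 × Fin 5)).map fun p => usoAlg p.1 p.2, ?_, ?_⟩
  · intro A hA s hs
    obtain ⟨⟨v, k⟩, -, rfl⟩ := (PMF.mem_support_map_iff _ _ _).1 hA
    have h := forall_outmap (p := fun s => usoBits s = true → ∀ v ∈ allBits, ∀ k,
      (((usoAlg v k).run s).any fun u => eqBits (s u) ![false, false]) = true)
      usoAlg_correct s hs.usoBits v (mem_allBits v) k
    obtain ⟨u, hu, hus⟩ := List.any_eq_true.1 h
    exact ⟨u, hu, by rw [zeroBits_two, ← eqBits_iff, hus]⟩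
  · intro s hs
    have h := forall_outmap (p := fun s => usoBits s = true →
      (allBits.map fun v => ((List.finRange 5).map fun k => (usoAlg v k).numQueries s).sum).sum
        ≤ 43) usoAlg_numQueries s hs.usoBits
    have h2 : ∑ p : Bits 2 × Fin 5, (usoAlg p.1 p.2).numQueries s ≤ 43 := by
      have h1 : allBits.toFinset = Finset.univ := by
        ext u
        simp [mem_allBits]
      rw [Fintype.sum_prod_type, ← h1, List.sum_toFinset _ allBits_nodup]
      simpa only [← List.ofFn_eq_map, List.sum_ofFn] using h
    rw [RandAlg.expectedQueries, tsum_map_mul, tsum_fintype]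
    simp only [PMF.uniformOfFintype_apply]
    rw [← Finset.mul_sum, ENNReal.div_eq_inv_mul, ← Nat.cast_sum]
    refine mul_le_mul' (le_of_eq ?_) (by exact_mod_cast h2)
    simp [Fintype.card_prod]

/-! ### Weighted families of outmaps -/

/-- Weighted outmaps that force the lower bound for Sink-or-Clash. -/
def hardOutmaps : List (ℕ × Outmap 2) :=
  let o := ![true, false]
  let t := ![false, true]
  let b := ![true, true]
  [(2, mkOutmap o o t b), (2, mkOutmap o o b t), (2, mkOutmap o t b t), (2, mkOutmap t o t b),
    (2, mkOutmap t b o o), (2, mkOutmap t b t o), (2, mkOutmap b t o o), (2, mkOutmap b t o t),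
    (5, mkOutmap o t t o), (5, mkOutmap t o o t), (1, mkOutmap o t b b), (1, mkOutmap o b t b),
    (1, mkOutmap t o b b), (1, mkOutmap t b o b), (1, mkOutmap b o b t), (1, mkOutmap b t b o),
    (1, mkOutmap b b o t), (1, mkOutmap b b t o)]

/-- Weighted unique sink orientations that force the lower bound for Sink-USO. -/
def hardUSOs : List (ℕ × Outmap 2) :=
  let z := ![false, false]
  let o := ![true, false]
  let t := ![false, true]
  let b := ![true, true]
  [(1, mkOutmap z o t b), (1, mkOutmap o z b t), (1, mkOutmap t b z o), (1, mkOutmap b t o z),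
    (2, mkOutmap z o b t), (2, mkOutmap z b t o), (2, mkOutmap o z t b), (2, mkOutmap o t b z),
    (2, mkOutmap t o z b), (2, mkOutmap t b o z), (2, mkOutmap b z o t), (2, mkOutmap b t z o)]

/-- Boolean version of `Solved` on the 2-cube. -/
def solvedBits (R : List (Bits 2)) (s : Outmap 2) : Bool :=
  (R.any fun u => eqBits (s u) ![false, false]) ||
    R.any fun u => R.any fun v => clashBits u (s u) v (s v)

/-- Boolean test whether the sink is among the queries in `R`. -/
def sinkBits (R : List (Bits 2)) (s : Outmap 2) : Bool :=
  R.any fun u => eqBits (s u) ![false, false]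

/-- No outmap in the family has a sink, so a clash has to be found. -/
theorem lowerVal_hardOutmaps : lowerVal allBits eqBits solvedBits 4 [] hardOutmaps = 92 := by
  decide +kernel

/-- The family consists of all twelve unique sink orientations of the square, with weight `1` if
source and sink are antipodal and `2` if they are adjacent. -/
theorem lowerVal_hardUSOs : lowerVal allBits eqBits sinkBits 4 [] hardUSOs = 43 := by
  decide +kernel

theorem isUSO_of_mem_hardUSOs : ∀ p ∈ hardUSOs, IsUSO p.2 := by
  simp only [IsUSO, IsOrientation, face, ExistsUnique, Set.mem_ofPred_eq]
  decide +kernel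

/-! ### The optimal values -/

theorem le_sinkOrClashCost {μ : RandAlg 2} (hμ : μ.SolvesSinkOrClash) {c : ℝ≥0∞}
    (hc : ∀ s, μ.expectedQueries s ≤ c) : 46 / 17 ≤ c := by
  have h := lowerVal_le_of_expectedQueries_le (solved := solvedBits) allBits_nodup mem_allBits
    eqBits_iff μ 4 hardOutmaps ?_ fun p _ => hc p.2
  · have h34 : (hardOutmaps.map Prod.fst).sum = 34 := by decide
    rw [lowerVal_hardOutmaps, h34] at h
    refine ENNReal.div_le_of_le_mul' ?_
    -- The family gives `92 ≤ 34 * c`; the common factor two is cancelled.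
    have h2 : (2 : ℝ≥0∞) * 46 ≤ 2 * (17 * c) := by
      rw [← mul_assoc]
      norm_num at h ⊢
      exact h
    exact (ENNReal.mul_le_mul_iff_right two_ne_zero ENNReal.ofNat_ne_top).1 h2
  · intro A hA p _ R hR
    simp only [solvedBits, Bool.or_eq_true, List.any_eq_true, eqBits_iff, clashBits_iff,
      ← zeroBits_two]
    exact (hμ A hA p.2).imp (fun ⟨u, hu, h⟩ => ⟨u, hR hu, h⟩)
      fun ⟨u, hu, v, hv, h⟩ => ⟨u, hR hu, v, hR hv, h⟩

theorem le_sinkUSOCost {μ : RandAlg 2} (hμ : μ.SolvesSinkUSO) {c : ℝ≥0∞}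
    (hc : ∀ s, IsUSO s → μ.expectedQueries s ≤ c) : 43 / 20 ≤ c := by
  have h := lowerVal_le_of_expectedQueries_le (solved := sinkBits) allBits_nodup mem_allBits
    eqBits_iff μ 4 hardUSOs ?_ fun p hp => hc p.2 (isUSO_of_mem_hardUSOs p hp)
  · have h20 : (hardUSOs.map Prod.fst).sum = 20 := by decide
    rw [lowerVal_hardUSOs, h20] at h
    exact ENNReal.div_le_of_le_mul' (by exact_mod_cast h)
  · intro A hA p hp R hR
    simp only [sinkBits, List.any_eq_true, eqBits_iff, ← zeroBits_two]
    obtain ⟨u, hu, h⟩ := hμ A hA p.2 (isUSO_of_mem_hardUSOs p hp)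
    exact ⟨u, hR hu, h⟩

theorem isLeast_sinkOrClashCosts : IsLeast (sinkOrClashCosts 2) (46 / 17) := by
  constructor
  · obtain ⟨μ, h1, h2⟩ := lpFeasible_optSolution.exists_randAlg
    refine ⟨μ, h1, le_antisymm (le_sinkOrClashCost h1 (le_iSup _)) (iSup_le fun s => ?_)⟩
    refine (h2 s).trans (le_of_eq ?_)
    rw [ENNReal.ofReal_div_of_pos (by norm_num)]
    norm_num
  · rintro c ⟨μ, hμ, rfl⟩
    exact le_sinkOrClashCost hμ (le_iSup _)

theorem isLeast_sinkUSOCosts : IsLeast (sinkUSOCosts 2) (43 / 20) := by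
  have hle : ∀ (μ : RandAlg 2) (s : Outmap 2), IsUSO s → μ.expectedQueries s ≤
      ⨆ s : {s : Outmap 2 // IsUSO s}, μ.expectedQueries s.1 :=
    fun μ s hs => le_iSup (fun s : {s : Outmap 2 // IsUSO s} => μ.expectedQueries s.1) ⟨s, hs⟩
  constructor
  · obtain ⟨μ, h1, h2⟩ := exists_randAlg_sinkUSO
    exact ⟨μ, h1, le_antisymm (le_sinkUSOCost h1 (hle μ)) (iSup_le fun s => h2 s.1 s.2)⟩
  · rintro c ⟨μ, hμ, rfl⟩
    exact le_sinkUSOCost hμ (hle μ)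

theorem isLeast_lpFeasible :
    IsLeast {v : ℝ | ∃ x : Sequence 2 → ℝ, LPFeasible 2 x v} (46 / 17) := by
  refine ⟨⟨_, lpFeasible_optSolution⟩, ?_⟩
  rintro v ⟨x, hx⟩
  obtain ⟨μ, h1, h2⟩ := hx.exists_randAlg
  have h : ENNReal.ofReal (46 / 17) ≤ ENNReal.ofReal v := by
    refine le_trans (le_of_eq ?_) (le_sinkOrClashCost h1 h2)
    rw [ENNReal.ofReal_div_of_pos (by norm_num)]
    norm_num
  -- `ENNReal.ofReal` truncates negative values, but it is strictly monotone below the positive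
  -- number `46 / 17` in the sense needed: `v < 46 / 17` gives a strict inequality of images.
  by_contra! hv
  exact absurd h (not_le.2 ((ENNReal.ofReal_lt_ofReal_iff (by norm_num)).2 hv))

end SinkOrClash

theorem mainTheorem7 :
    (SinkOrClash.tTilde 2 = 46 / 17 ∧
      IsLeast (SinkOrClash.sinkOrClashCosts 2) (SinkOrClash.tTilde 2)) ∧
    (SinkOrClash.qTilde 2 = 43 / 20 ∧
      IsLeast (SinkOrClash.sinkUSOCosts 2) (SinkOrClash.qTilde 2)) ∧
    SinkOrClash.qTilde 2 < SinkOrClash.tTilde 2 ∧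
    IsLeast {v : ℝ | ∃ x : SinkOrClash.Sequence 2 → ℝ, SinkOrClash.LPFeasible 2 x v}
      (46 / 17) := by
  have ht := SinkOrClash.isLeast_sinkOrClashCosts
  have hq := SinkOrClash.isLeast_sinkUSOCosts
  have ht' : SinkOrClash.tTilde 2 = 46 / 17 := ht.csInf_eq
  have hq' : SinkOrClash.qTilde 2 = 43 / 20 := hq.csInf_eq
  rw [ht', hq']
  refine ⟨⟨rfl, ht⟩, ⟨rfl, hq⟩, ?_, SinkOrClash.isLeast_lpFeasible⟩
  rw [ENNReal.div_lt_iff (by norm_num) (by norm_num), ENNReal.div_eq_inv_mul, mul_assoc]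
  rw [← ENNReal.div_eq_inv_mul, ENNReal.lt_div_iff_mul_lt (by norm_num) (by norm_num)]
  norm_num
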